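/- Let $\mathcal H$ be a complex Hilbert space, with scalar product linear in the second entry. Let $S$ be a densely defined symmetric operator in $\mathcal H$, with closure $\overline S$, such that $0$ is a point of regular type of $\overline S$ (i.e. there is $c>0$ with $\|\overline S f\|\ge c\|f\|$ for all $f\in\mathcal D(\overline S)$) and $\dim\ker S^*\ge 1$. Let $S_{\mathrm D}$ be a self-adjoint extension of $S$ with everywhere defined and bounded inverse, and let $\widetilde S$ be a self-adjoint extension of $S$. For every $\varepsilon>0$ there is a unique unitary $U_\varepsilon:\ker(S^*-\mathrm i\varepsilon)\to\ker(S^*+\mathrm i\varepsilon)$ (the von Neumann parameter of $\widetilde S$) such that $$\mathcal D(\widetilde S)=\mathcal D(\overline S)+(1-U_\varepsilon)\ker(S^*-\mathrm i\varepsilon),\qquad \widetilde S(f+u-U_\varepsilon u)=\overline S f+\mathrm i\varepsilon u+\mathrm i\varepsilon U_\varepsilon u,$$ and there is a unique self-adjoint operator $T$ acting in a closed subspace of $\ker S^*$ (the Kreĭn–Višik–Birman parameter of $\widetilde S$ relative to $S_{\mathrm D}$) such that $$\mathcal D(\widetilde S)=\{f+S_{\mathrm D}^{-1}(Tu+w)+u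 \mid f\in\mathcal D(\overline S),\ u\in\mathcal D(T),\ w\in\ker S^*\cap\mathcal D(T)^\perp\},$$ $$\widetilde S\big(f+S_{\mathrm D}^{-1}(Tu+w)+u\big)=\overline S f+Tu+w .$$ For every $\varepsilon>0$, each $g\in\mathcal D(\widetilde S)$ is uniquely decomposed as $g=f_\varepsilon^{(g)}+u_\varepsilon^{(g)}-U_\varepsilon u_\varepsilon^{(g)}$ with $f_\varepsilon^{(g)}\in\mathcal D(\overline S)$ and $u_\varepsilon^{(g)}\in\ker(S^*-\mathrm i\varepsilon)$. Moreover, for every $g\in\mathcal D(\widetilde S)$ the limit $$u^{(g)}:=\lim_{\varepsilon\downarrow0}(1-S_{\mathrm D}^{-1}\widetilde S)\big(u_\varepsilon^{(g)}-U_\varepsilon u_\varepsilon^{(g)}\big)$$ exists in $\mathcal H$ and belongs to $\mathcal D(T)\subset\ker S^*$; one has $$\mathcal D(T)=\{u^{(g)}\mid g\in\mathcal D(\widetilde S)\};$$ and for every $g\in\mathcal D(\widetilde S)$ $$\langle u^{(g)},Tu^{(g)}\rangle=\lim_{\varepsilon\downarrow0}\mathrm i\varepsilon\,\big\langle(1-S_{\mathrm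 D}^{-1}\widetilde S)(u_\varepsilon^{(g)}-U_\varepsilon u_\varepsilon^{(g)}),\,u_\varepsilon^{(g)}+U_\varepsilon u_\varepsilon^{(g)}\big\rangle .$$ -/

import Mathlib

open Filter Topology
open scoped LinearPMap

namespace ExtensionTheory

noncomputable section

variable {H : Type*} [NormedAddCommGroup H] [InnerProductSpace ℂ H]

/-- `z` is a point of regular type of the operator `A`: `A - z` is injective with bounded inverse
on its range. -/
def IsRegularPoint (A : H →ₗ.[ℂ] H) (z : ℂ) : Prop :=
  ∃ c : ℝ, 0 < c ∧ ∀ f : A.domain, c * ‖(f : H)‖ ≤ ‖A f - z • (f : H)‖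

/-- `B` is the everywhere defined and bounded inverse of the operator `A`. -/
structure IsBoundedInverse (A : H →ₗ.[ℂ] H) (B : H →L[ℂ] H) : Prop where
  left_inv : ∀ x : A.domain, B (A x) = x
  mem_domain : ∀ y : H, B y ∈ A.domain
  right_inv : ∀ y : H, A ⟨B y, mem_domain y⟩ = y

/-- The map `1 - B A` on the domain of `A`. -/
def oneSubComp (B : H →L[ℂ] H) (A : H →ₗ.[ℂ] H) : A.domain →ₗ[ℂ] H :=
  A.domain.subtype - B.toLinearMap ∘ₗ A.toFun

/-- A self-adjoint operator acting in a closed subspace of `N`: a closed subspace `space` of `H`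
contained in `N`, and a self-adjoint operator in the Hilbert space `space`. -/
structure SelfAdjointIn [CompleteSpace H] (N : Submodule ℂ H) where
  space : Submodule ℂ H
  space_le : space ≤ N
  isClosed : IsClosed (space : Set H)
  op : space →ₗ.[ℂ] space
  isSelfAdjoint : haveI : CompleteSpace space := isClosed.completeSpace_coe
    IsSelfAdjoint op

namespace SelfAdjointIn

variable [CompleteSpace H] {N : Submodule ℂ H}

/-- The domain of the operator, as a subspace of `H`. -/
def dom (T : SelfAdjointIn N) : Submodule ℂ H :=
  T.op.domain.map T.space.subtype

end SelfAdjointIn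

variable [CompleteSpace H]

/-- The deficiency subspace `ker (S* - z)`. -/
def defectSpace (S : H →ₗ.[ℂ] H) (z : ℂ) : Submodule ℂ H :=
  (LinearMap.ker (S†.toFun - z • S†.domain.subtype)).map S†.domain.subtype

/-- `ker (S* - iε)`. -/
abbrev defectPlus (S : H →ₗ.[ℂ] H) (ε : ℝ) : Submodule ℂ H :=
  defectSpace S (Complex.I * ε)

/-- `ker (S* + iε)`. -/
abbrev defectMinus (S : H →ₗ.[ℂ] H) (ε : ℝ) : Submodule ℂ H :=
  defectSpace S (-(Complex.I * ε))

/-- The map `1 - U` on `ker (S* - iε)`. -/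
def oneSubUnitary (S : H →ₗ.[ℂ] H) (ε : ℝ) (U : defectPlus S ε ≃ₗᵢ[ℂ] defectMinus S ε) :
    defectPlus S ε →ₗ[ℂ] H :=
  (defectPlus S ε).subtype - (defectMinus S ε).subtype ∘ₗ U.toLinearEquiv.toLinearMap

/-- The unitary `U : ker (S* - iε) → ker (S* + iε)` is the von Neumann parameter of the
extension `A` of `S`: the domain of `A` is `D(S̄) + (1 - U) ker (S* - iε)`, and
`A (f + u - U u) = S̄ f + iε u + iε U u`. -/
structure IsVonNeumannParameter (S A : H →ₗ.[ℂ] H) (ε : ℝ)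
    (U : defectPlus S ε ≃ₗᵢ[ℂ] defectMinus S ε) : Prop where
  domain_eq : A.domain = S.closure.domain ⊔ LinearMap.range (oneSubUnitary S ε U)
  apply_eq : ∀ (g : A.domain) (f : S.closure.domain) (u : defectPlus S ε),
    (g : H) = f + oneSubUnitary S ε U u →
      A g = S.closure f + (Complex.I * ε) • (u : H) + (Complex.I * ε) • (U u : H)

theorem IsVonNeumannParameter.sub_mem {S A : H →ₗ.[ℂ] H} {ε : ℝ}
    {U : defectPlus S ε ≃ₗᵢ[ℂ] defectMinus S ε} (h : IsVonNeumannParameter S A ε U)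
    (u : defectPlus S ε) : (u : H) - (U u : H) ∈ A.domain := by
  rw [h.domain_eq]
  exact Submodule.mem_sup_right ⟨u, rfl⟩

/-- The self-adjoint operator `T` in a closed subspace of `ker S*` is the
Kreĭn–Višik–Birman parameter of the extension `A` of `S`, relative to the distinguished extension
whose inverse is `B`: the domain of `A` consists of the vectors `f + B (T u + w) + u` with
`f ∈ D(S̄)`, `u ∈ D(T)`, `w ∈ ker S* ∩ D(T)ᗮ`, and `A` maps such a vector to `S̄ f + T u + w`. -/
structure IsKVBParameter (S : H →ₗ.[ℂ] H) (B : H →L[ℂ] H) (A : H →ₗ.[ℂ] H)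
    (T : SelfAdjointIn (defectSpace S 0)) : Prop where
  mem_domain_iff : ∀ g : H, g ∈ A.domain ↔
    ∃ (f : S.closure.domain) (u : T.op.domain) (w : H),
      w ∈ defectSpace S 0 ⊓ T.domᗮ ∧ g = f + B ((T.op u : H) + w) + ((u : T.space) : H)
  apply_eq : ∀ (g : A.domain) (f : S.closure.domain) (u : T.op.domain) (w : H),
    w ∈ defectSpace S 0 ⊓ T.domᗮ → (g : H) = f + B ((T.op u : H) + w) + ((u : T.space) : H) →
      A g = S.closure f + (T.op u : H) + w

/-- The one-sided limit `ε ↓ 0`, as a filter on the positive reals. -/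
def epsToZero : Filter (Set.Ioi (0 : ℝ)) :=
  comap ((↑) : Set.Ioi (0 : ℝ) → ℝ) (𝓝[>] 0)

end

end ExtensionTheory

open ExtensionTheory

/-!
The Kreĭn–Višik–Birman parameter is read off a self-adjoint linear relation. Since `S_D⁻¹` is
bounded and symmetric, `(S̃⁻¹ - S_D⁻¹)⁻¹ = {(x, t) | (x + S_D⁻¹ t, t) ∈ graph S̃}` is self-adjoint
as a relation, even if `S̃` is not invertible. Its multivalued part contains `ran S̄`, because
`S_D⁻¹ S̄ = 1`, so its domain lies in `ker S*`; its operator part is `T`. In particular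
`D(T) = ran (1 - S_D⁻¹ S̃)`.

The von Neumann parameter `U_ε` is the restriction of the Cayley transform of `S̃` to
`ker (S* - iε)`.

As `1 - S_D⁻¹ S̃` vanishes on `D(S̄)`, its value at `u_ε - U_ε u_ε` is its value at `g`, for every
`ε`. Pairing `S̃ g = S̄ f_ε + iε (u_ε + U_ε u_ε)` with that vector of `ker S* = (ran S̄)ᗮ` removes
the first term, so the second expression does not depend on `ε` either, and both limits are limits
of constants.
-/

namespace ExtensionTheory

open ComplexConjugate

section Module

variable {R E F : Type*} [CommRing R] [AddCommGroup E] [Module R E] [AddCommGroup F] [Module R F]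

theorem apply_eq_of_le {S A : E →ₗ.[R] F} (hSA : S ≤ A) (x : S.domain) :
    A ⟨x, hSA.1 x.2⟩ = S x :=
  (hSA.2 rfl).symm

theorem closure_le_of_isClosed [TopologicalSpace R] [TopologicalSpace E] [TopologicalSpace F]
    [ContinuousAdd E] [ContinuousAdd F] [ContinuousSMul R E] [ContinuousSMul R F]
    {S A : E →ₗ.[R] F} (hA : A.IsClosed) (hSA : S ≤ A) : S.closure ≤ A := by
  rw [← LinearPMap.le_graph_iff,
    ← (hA.isClosable.leIsClosable hSA).graph_closure_eq_closure_graph]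
  exact Submodule.topologicalClosure_minimal _ (LinearPMap.le_graph_of_le hSA) hA

/-- The linear relation `(r⁻¹ - B)⁻¹`, written without inverses:
`{(x, t) | (x + B t, t) ∈ r}`. -/
def subFromInverse (r : Submodule R (E × F)) (B : F →ₗ[R] E) : Submodule R (E × F) :=
  r.comap ((LinearMap.fst R E F + B ∘ₗ LinearMap.snd R E F).prod (LinearMap.snd R E F))

theorem mem_subFromInverse {r : Submodule R (E × F)} {B : F →ₗ[R] E} {x : E} {t : F} :
    (x, t) ∈ subFromInverse r B ↔ (x + B t, t) ∈ r :=
  Iff.rfl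

end Module

section LinearRelation

variable {𝕜 E F : Type*} [RCLike 𝕜] [NormedAddCommGroup E] [InnerProductSpace 𝕜 E]
  [NormedAddCommGroup F] [InnerProductSpace 𝕜 F]

theorem adjoint_topologicalClosure (R : Submodule 𝕜 (E × F)) :
    R.topologicalClosure.adjoint = R.adjoint := by
  ext p
  rw [Submodule.mem_adjoint_iff, Submodule.mem_adjoint_iff]
  refine ⟨fun h a b hab => h a b (R.le_topologicalClosure hab), fun h a b hab => ?_⟩
  have hclosed : IsClosed {q : E × F | inner 𝕜 q.2 p.1 - inner 𝕜 q.1 p.2 = 0} :=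
    isClosed_eq (by fun_prop) continuous_const
  exact closure_minimal (fun q hq => h q.1 q.2 hq) hclosed hab

theorem mk_zero_mem_adjoint_iff {R : Submodule 𝕜 (E × F)} {t : E} :
    ((0 : F), t) ∈ R.adjoint ↔ t ∈ (R.map (LinearMap.fst 𝕜 E F))ᗮ := by
  simp [Submodule.mem_orthogonal]

theorem adjoint_closure [CompleteSpace E] {A : E →ₗ.[𝕜] F} (hA : Dense (A.domain : Set E))
    (hA' : A.IsClosable) : A.closure† = A† := by
  have hdense : Dense (A.closure.domain : Set E) := hA.mono A.le_closure.1
  refine LinearPMap.eq_of_eq_graph ?_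
  rw [LinearPMap.adjoint_graph_eq_graph_adjoint hdense, ← hA'.graph_closure_eq_closure_graph,
    adjoint_topologicalClosure, LinearPMap.adjoint_graph_eq_graph_adjoint hA]

theorem isSelfAdjoint_iff_adjoint_graph [CompleteSpace E] {A : E →ₗ.[𝕜] E}
    (hA : Dense (A.domain : Set E)) : IsSelfAdjoint A ↔ A.graph.adjoint = A.graph := by
  rw [LinearPMap.isSelfAdjoint_def, ← LinearPMap.adjoint_graph_eq_graph_adjoint hA]
  exact ⟨congrArg LinearPMap.graph, LinearPMap.eq_of_eq_graph⟩

theorem isFormalAdjoint_of_isSelfAdjoint [CompleteSpace E] {A : E →ₗ.[𝕜] E}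
    (hA : IsSelfAdjoint A) : A.IsFormalAdjoint A := by
  have h := LinearPMap.adjoint_isFormalAdjoint hA.dense_domain
  rwa [LinearPMap.isSelfAdjoint_def.1 hA] at h

theorem adjoint_subFromInverse {R : Submodule 𝕜 (E × E)} (hR : R.adjoint = R) {B : E →ₗ[𝕜] E}
    (hB : B.IsSymmetric) : (subFromInverse R B).adjoint = subFromInverse R B := by
  ext ⟨x, t⟩
  conv_rhs => rw [mem_subFromInverse, ← hR]
  simp only [Submodule.mem_adjoint_iff, mem_subFromInverse]
  refine ⟨fun h a b hab => ?_, fun h a b hab => ?_⟩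
  · rw [← h (a - B b) b (by rwa [sub_add_cancel]), inner_add_right, inner_sub_left, hB]
    ring
  · rw [← h (a + B b) b hab, inner_add_right, inner_add_left, hB]
    ring

/-- The closure of the domain of a linear relation, which is the space its operator part acts
in. -/
def closedDomain (R : Submodule 𝕜 (E × E)) : Submodule 𝕜 E :=
  (R.map (LinearMap.fst 𝕜 E E)).topologicalClosure

/-- The operator part of a linear relation `R`: the part of `R` in the closure of its domain. It is
only meaningful if that part is single-valued, as it is for self-adjoint `R`. -/
noncomputable def operatorPart (R : Submodule 𝕜 (E × E)) :
    closedDomain R →ₗ.[𝕜] closedDomain R :=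
  (R.comap ((closedDomain R).subtype.prodMap (closedDomain R).subtype)).toLinearPMap

section SelfAdjoint

variable {R : Submodule 𝕜 (E × E)} (hR : R.adjoint = R)

include hR

theorem mk_zero_mem_iff {t : E} : ((0 : E), t) ∈ R ↔ t ∈ (closedDomain R)ᗮ := by
  rw [closedDomain, Submodule.orthogonal_closure, ← mk_zero_mem_adjoint_iff, hR]

theorem mem_graph_operatorPart {p : closedDomain R × closedDomain R} :
    p ∈ (operatorPart R).graph ↔ ((p.1 : E), (p.2 : E)) ∈ R := by
  rw [operatorPart, Submodule.toLinearPMap_graph_eq]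
  · rfl
  rintro ⟨x, t⟩ hxt (rfl : x = 0)
  have ht : (t : E) ∈ (closedDomain R)ᗮ := (mk_zero_mem_iff hR).1 hxt
  exact Subtype.ext (inner_self_eq_zero.1 (ht t t.2))

variable [CompleteSpace (closedDomain R)]

theorem mk_projection_mem_graph_operatorPart {x t : E} (hxt : (x, t) ∈ R) :
    ∃ hx : x ∈ closedDomain R,
      (⟨x, hx⟩, (closedDomain R).orthogonalProjectionOnto t) ∈ (operatorPart R).graph := by
  refine ⟨Submodule.le_topologicalClosure _ ⟨_, hxt, rfl⟩, (mem_graph_operatorPart hR).2 ?_⟩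
  have h := R.sub_mem hxt ((mk_zero_mem_iff hR).2
    ((closedDomain R).sub_starProjection_mem_orthogonal t))
  simpa using h

theorem map_domain_operatorPart :
    (operatorPart R).domain.map (closedDomain R).subtype = R.map (LinearMap.fst 𝕜 E E) := by
  ext x
  constructor
  · rintro ⟨x, hx, rfl⟩
    exact ⟨_, (mem_graph_operatorPart hR).1 ((operatorPart R).mem_graph ⟨x, hx⟩), rfl⟩
  · rintro ⟨⟨x, t⟩, hxt, rfl⟩
    obtain ⟨hx, hgraph⟩ := mk_projection_mem_graph_operatorPart hR hxt
    exact ⟨⟨x, hx⟩, LinearPMap.mem_domain_of_mem_graph hgraph, rfl⟩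

theorem dense_domain_operatorPart :
    Dense ((operatorPart R).domain : Set (closedDomain R)) := by
  refine Subtype.dense_iff.2 fun x hx => ?_
  have himage : (closedDomain R).subtype '' (operatorPart R).domain =
      (R.map (LinearMap.fst 𝕜 E E) : Set E) := by
    rw [← map_domain_operatorPart hR, Submodule.map_coe]
  exact himage ▸ hx

theorem isSelfAdjoint_operatorPart : IsSelfAdjoint (operatorPart R) := by
  have hdense := dense_domain_operatorPart hR
  refine (isSelfAdjoint_iff_adjoint_graph hdense).2 ?_
  ext ⟨x, t⟩
  have hmem : ((x : E), (t : E)) ∈ R ↔ ((x : E), (t : E)) ∈ R.adjoint := by rw [hR]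
  rw [mem_graph_operatorPart hR, hmem, Submodule.mem_adjoint_iff, Submodule.mem_adjoint_iff]
  refine ⟨fun h a b hab => ?_, fun h a b hab => h a b ((mem_graph_operatorPart hR).1 hab)⟩
  obtain ⟨ha, hgraph⟩ := mk_projection_mem_graph_operatorPart hR hab
  rw [← h _ _ hgraph, Submodule.inner_orthogonalProjectionOnto_eq_of_mem_right]
  rfl

end SelfAdjoint

end LinearRelation

section Shift

variable {H : Type*} [NormedAddCommGroup H] [InnerProductSpace ℂ H] {S A : H →ₗ.[ℂ] H} {z : ℂ}

/-- The map `A - z` on the domain of `A`. -/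
def shift (A : H →ₗ.[ℂ] H) (z : ℂ) : A.domain →ₗ[ℂ] H :=
  A.toFun - z • A.domain.subtype

theorem shift_apply (f : A.domain) : shift A z f = A f - z • (f : H) :=
  rfl

theorem IsRegularPoint.mono (h : IsRegularPoint A z) (hSA : S ≤ A) : IsRegularPoint S z := by
  obtain ⟨c, hc, hbound⟩ := h
  exact ⟨c, hc, fun f => by simpa only [apply_eq_of_le hSA f] using hbound ⟨f, hSA.1 f.2⟩⟩

theorem shift_injective (h : IsRegularPoint A z) : Function.Injective (shift A z) := by
  obtain ⟨c, hc, hbound⟩ := h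
  refine (injective_iff_map_eq_zero _).2 fun f hf => ?_
  have hle : c * ‖(f : H)‖ ≤ 0 := by simpa [← shift_apply, hf] using hbound f
  exact Subtype.ext (norm_le_zero_iff.1 (nonpos_of_mul_nonpos_right hle hc))

theorem exists_norm_graph_le_norm_shift (h : IsRegularPoint A z) :
    ∃ K : NNReal, ∀ f : A.domain, ‖((f : H), A f)‖ ≤ K * ‖shift A z f‖ := by
  obtain ⟨c, hc, hbound⟩ := h
  refine ⟨⟨c⁻¹ + 1 + ‖z‖ * c⁻¹, by positivity⟩, fun f => ?_⟩
  have hf : ‖(f : H)‖ ≤ c⁻¹ * ‖shift A z f‖ := (le_inv_mul_iff₀ hc).2 (hbound f)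
  have hzf := mul_le_mul_of_nonneg_left hf (norm_nonneg z)
  have hAf : ‖A f‖ ≤ ‖shift A z f‖ + ‖z‖ * ‖(f : H)‖ := by
    simpa [shift_apply, norm_smul] using norm_le_norm_sub_add (A f) (z • (f : H))
  calc ‖((f : H), A f)‖ ≤ ‖(f : H)‖ + ‖A f‖ :=
        max_le_add_of_nonneg (norm_nonneg _) (norm_nonneg _)
    _ ≤ (c⁻¹ + 1 + ‖z‖ * c⁻¹) * ‖shift A z f‖ := by linarith

theorem isClosed_range_shift [CompleteSpace H] (hA : A.IsClosed) (h : IsRegularPoint A z) :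
    IsClosed (LinearMap.range (shift A z) : Set H) := by
  have : CompleteSpace A.graph := hA.isComplete.completeSpace_coe
  let L : A.graph →L[ℂ] H :=
    (ContinuousLinearMap.snd ℂ H H - z • ContinuousLinearMap.fst ℂ H H) ∘L A.graph.subtypeL
  have hL_apply (f : A.domain) : L ⟨_, A.mem_graph f⟩ = shift A z f := rfl
  have hrange : Set.range L = LinearMap.range (shift A z) := by
    ext y
    constructor
    · rintro ⟨⟨⟨x, t⟩, hxt⟩, rfl⟩
      obtain ⟨f, rfl, rfl⟩ := A.mem_graph_iff.1 hxt
      exact ⟨f, (hL_apply f).symm⟩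
    · rintro ⟨f, rfl⟩
      exact ⟨_, hL_apply f⟩
  obtain ⟨K, hK⟩ := exists_norm_graph_le_norm_shift h
  have hL : AntilipschitzWith K L := by
    refine L.antilipschitz_of_bound ?_
    rintro ⟨⟨x, t⟩, hxt⟩
    obtain ⟨f, rfl, rfl⟩ := A.mem_graph_iff.1 hxt
    exact hK f
  exact hrange ▸ hL.isClosed_range L.uniformContinuous

theorem isRegularPoint_of_im_ne_zero (hA : A.IsFormalAdjoint A) (hz : z.im ≠ 0) :
    IsRegularPoint A z := by
  refine ⟨|z.im|, abs_pos.2 hz, fun f => ?_⟩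
  have hreal : (inner ℂ (f : H) (A f)).im = 0 := by
    rw [← Complex.conj_eq_iff_im, inner_conj_symm, hA f f]
  have him : (inner ℂ (f : H) (A f - z • (f : H))).im = -(z.im * ‖(f : H)‖ ^ 2) := by
    have hself : inner ℂ (f : H) (f : H) = ((‖(f : H)‖ ^ 2 : ℝ) : ℂ) := by simp
    rw [inner_sub_right, inner_smul_right, hself, Complex.sub_im, hreal, Complex.im_mul_ofReal,
      zero_sub]
  rcases eq_or_ne (f : H) 0 with hf | hf
  · simp [hf]
  · refine le_of_mul_le_mul_left ?_ (norm_pos_iff.2 hf)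
    calc ‖(f : H)‖ * (|z.im| * ‖(f : H)‖)
        = |(inner ℂ (f : H) (A f - z • (f : H))).im| := by
          rw [him, abs_neg, abs_mul, abs_of_nonneg (sq_nonneg ‖(f : H)‖)]; ring
      _ ≤ ‖inner ℂ (f : H) (A f - z • (f : H))‖ := Complex.abs_im_le_norm _
      _ ≤ ‖(f : H)‖ * ‖A f - z • (f : H)‖ := norm_inner_le_norm _ _

theorem norm_shift_conj (hA : A.IsFormalAdjoint A) (f : A.domain) :
    ‖shift A (conj z) f‖ = ‖shift A z f‖ := by
  have hcross : inner ℂ (A f) (conj z • (f : H)) = inner ℂ (z • (f : H)) (A f) := by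
    rw [inner_smul_right, inner_smul_left, hA f f]
  refine (sq_eq_sq₀ (norm_nonneg _) (norm_nonneg _)).1 ?_
  rw [shift_apply, shift_apply, norm_sub_sq (𝕜 := ℂ), norm_sub_sq (𝕜 := ℂ), hcross, inner_re_symm,
    norm_smul, norm_smul, RCLike.norm_conj]

end Shift

section DefectSpace

variable {H : Type*} [NormedAddCommGroup H] [InnerProductSpace ℂ H] [CompleteSpace H]
  {S A : H →ₗ.[ℂ] H} {z : ℂ}

theorem le_adjoint_of_le (hS : Dense (S.domain : Set H)) (hA : A.IsFormalAdjoint A)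
    (hSA : S ≤ A) : A ≤ S† := by
  refine LinearPMap.IsFormalAdjoint.le_adjoint hS fun x y => ?_
  rw [← apply_eq_of_le hSA x]
  exact hA ⟨x, hSA.1 x.2⟩ y

theorem mem_defectSpace_iff_mem_graph {x : H} :
    x ∈ defectSpace S z ↔ (x, z • x) ∈ S†.graph := by
  rw [LinearPMap.mem_graph_iff]
  constructor
  · rintro ⟨y, hy, rfl⟩
    exact ⟨y, rfl, sub_eq_zero.1 hy⟩
  · rintro ⟨y, rfl, hy⟩
    exact ⟨y, sub_eq_zero.2 hy, rfl⟩

theorem defectSpace_closure (hS : Dense (S.domain : Set H)) (hS' : S.IsClosable) :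
    defectSpace S.closure z = defectSpace S z := by
  ext x
  rw [mem_defectSpace_iff_mem_graph, mem_defectSpace_iff_mem_graph, adjoint_closure hS hS']

theorem defectSpace_eq_orthogonal (hS : Dense (S.domain : Set H)) :
    defectSpace S z = (LinearMap.range (shift S (conj z)))ᗮ := by
  ext x
  rw [mem_defectSpace_iff_mem_graph, LinearPMap.adjoint_graph_eq_graph_adjoint hS,
    Submodule.mem_adjoint_iff, Submodule.mem_orthogonal]
  constructor
  · rintro h _ ⟨f, rfl⟩
    simpa [shift_apply, inner_sub_left, inner_smul_left, inner_smul_right]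
      using h f (S f) (S.mem_graph f)
  · rintro h a b hab
    obtain ⟨f, rfl, rfl⟩ := S.mem_graph_iff.1 hab
    simpa [shift_apply, inner_sub_left, inner_smul_left, inner_smul_right]
      using h _ ⟨f, rfl⟩

theorem defectSpace_eq_orthogonal_closure (hS : Dense (S.domain : Set H)) (hS' : S.IsClosable) :
    defectSpace S z = (LinearMap.range (shift S.closure (conj z)))ᗮ := by
  rw [← defectSpace_closure hS hS',
    defectSpace_eq_orthogonal (hS.mono S.le_closure.1)]

theorem exists_shift_closure_add (hS : Dense (S.domain : Set H)) (hS' : S.IsClosable)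
    (h : IsRegularPoint S.closure (conj z)) (y : H) :
    ∃ f : S.closure.domain, ∃ n ∈ defectSpace S z, shift S.closure (conj z) f + n = y := by
  have : CompleteSpace (LinearMap.range (shift S.closure (conj z))) :=
    (isClosed_range_shift hS'.closure_isClosed h).completeSpace_coe
  have hy := Submodule.mem_top (x := y) (R := ℂ)
  rw [← Submodule.sup_orthogonal_of_hasOrthogonalProjection
    (K := LinearMap.range (shift S.closure (conj z))), Submodule.mem_sup] at hy
  obtain ⟨_, ⟨f, rfl⟩, n, hn, rfl⟩ := hy
  exact ⟨f, n, (defectSpace_eq_orthogonal_closure hS hS').ge hn, rfl⟩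

theorem existsUnique_shift_closure_add_smul (hS : Dense (S.domain : Set H))
    (hS' : S.IsClosable) (h : IsRegularPoint S.closure (conj z)) {c : ℂ} (hc : c ≠ 0) (y : H) :
    ∃! p : S.closure.domain × defectSpace S z,
      shift S.closure (conj z) p.1 + c • (p.2 : H) = y := by
  obtain ⟨f, n, hn, rfl⟩ := exists_shift_closure_add hS hS' h y
  refine ⟨(f, c⁻¹ • ⟨n, hn⟩), by simp [hc], ?_⟩
  rintro ⟨f', u⟩ hp
  have hdiff : shift S.closure (conj z) (f' - f) = n - c • (u : H) := by
    rw [map_sub, sub_eq_sub_iff_add_eq_add, hp, add_comm]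
  have hmem : n - c • (u : H) ∈ defectSpace S z :=
    Submodule.sub_mem _ hn (Submodule.smul_mem _ c u.2)
  have hzero : n - c • (u : H) = 0 := by
    exact inner_self_eq_zero.1 ((defectSpace_eq_orthogonal_closure hS hS').le hmem _ ⟨_, hdiff⟩)
  have hf : f' - f = 0 := shift_injective h (by rw [hdiff, hzero, map_zero])
  refine Prod.ext (sub_eq_zero.1 hf) (Subtype.ext ?_)
  rw [sub_eq_zero] at hzero
  simp [hzero, hc]

theorem defectSpace_eq_bot (hA : IsSelfAdjoint A) (hz : z.im ≠ 0) : defectSpace A z = ⊥ := by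
  refine (Submodule.eq_bot_iff _).2 fun x hx => ?_
  rw [mem_defectSpace_iff_mem_graph, LinearPMap.isSelfAdjoint_def.1 hA,
    LinearPMap.mem_graph_iff] at hx
  obtain ⟨f, rfl, hf⟩ := hx
  have hf : shift A z f = 0 := by rw [shift_apply, hf, sub_self]
  rw [shift_injective (isRegularPoint_of_im_ne_zero (isFormalAdjoint_of_isSelfAdjoint hA) hz)
    (hf.trans (map_zero _).symm), Submodule.coe_zero]

theorem shift_bijective (hA : IsSelfAdjoint A) (hz : z.im ≠ 0) :
    Function.Bijective (shift A z) := by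
  have hreg := isRegularPoint_of_im_ne_zero (isFormalAdjoint_of_isSelfAdjoint hA) hz
  refine ⟨shift_injective hreg, LinearMap.range_eq_top.1 ?_⟩
  have : CompleteSpace (LinearMap.range (shift A z)) :=
    (isClosed_range_shift hA.isClosed hreg).completeSpace_coe
  have hbot := defectSpace_eq_bot hA (z := conj z) (by simpa using hz)
  rw [defectSpace_eq_orthogonal hA.dense_domain, Complex.conj_conj] at hbot
  exact (Submodule.orthogonal_eq_bot_iff).1 hbot

end DefectSpace

section Cayley

variable {H : Type*} [NormedAddCommGroup H] [InnerProductSpace ℂ H] [CompleteSpace H]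
  {S A : H →ₗ.[ℂ] H} {z : ℂ}

theorem sub_conj_ne_zero (hz : z.im ≠ 0) : z - conj z ≠ 0 :=
  sub_ne_zero.2 fun h => hz (Complex.conj_eq_iff_im.1 h.symm)

theorem shift_conj_bijective (hA : IsSelfAdjoint A) (hz : z.im ≠ 0) :
    Function.Bijective (shift A (conj z)) :=
  shift_bijective hA (by simpa using hz)

/-- The Cayley transform `(A - z) (A - z̄)⁻¹` of a self-adjoint operator `A`, for nonreal `z`. -/
noncomputable def cayley (hA : IsSelfAdjoint A) (hz : z.im ≠ 0) : H ≃ₗᵢ[ℂ] H where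
  toLinearEquiv :=
    (LinearEquiv.ofBijective _ (shift_conj_bijective hA hz)).symm.trans
      (LinearEquiv.ofBijective _ (shift_bijective hA hz))
  norm_map' x := by
    obtain ⟨h, rfl⟩ := (LinearEquiv.ofBijective _ (shift_conj_bijective hA hz)).surjective x
    rw [LinearEquiv.trans_apply, LinearEquiv.symm_apply_apply]
    exact (norm_shift_conj (isFormalAdjoint_of_isSelfAdjoint hA) h).symm

variable (hA : IsSelfAdjoint A) (hz : z.im ≠ 0)

theorem cayley_shift (h : A.domain) : cayley hA hz (shift A (conj z) h) = shift A z h :=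
  congrArg (shift A z)
    ((LinearEquiv.ofBijective _ (shift_conj_bijective hA hz)).symm_apply_apply h)

theorem sub_mem_graph_iff {u v : H} :
    (u - v, z • u - conj z • v) ∈ A.graph ↔ cayley hA hz u = v := by
  constructor
  · intro huv
    obtain ⟨h, hh, hAh⟩ := A.mem_graph_iff.1 huv
    have hu : shift A (conj z) h = (z - conj z) • u := by
      rw [shift_apply, hh, hAh]; module
    have hv : shift A z h = (z - conj z) • v := by
      rw [shift_apply, hh, hAh]; module
    refine smul_right_injective H (sub_conj_ne_zero hz) ?_
    simp only [← map_smul, ← hu, ← hv, cayley_shift]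
  · rintro rfl
    obtain ⟨h, rfl⟩ := (shift_conj_bijective hA hz).2 u
    rw [cayley_shift]
    convert A.graph.smul_mem (z - conj z) (A.mem_graph h) using 1
    ext <;> simp only [shift_apply, Prod.smul_mk] <;> module

theorem cayley_mem_defectSpace_iff (hS : Dense (S.domain : Set H)) (hSA : S ≤ A) {u : H} :
    cayley hA hz u ∈ defectSpace S (conj z) ↔ u ∈ defectSpace S z := by
  have hgraph : (u, z • u) - (cayley hA hz u, conj z • cayley hA hz u) ∈ S†.graph :=
    LinearPMap.le_graph_of_le (le_adjoint_of_le hS (isFormalAdjoint_of_isSelfAdjoint hA) hSA)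
      ((sub_mem_graph_iff hA hz).2 rfl)
  rw [mem_defectSpace_iff_mem_graph, mem_defectSpace_iff_mem_graph]
  exact ⟨fun h => by simpa using add_mem hgraph h, fun h => by simpa using sub_mem h hgraph⟩

theorem map_cayley_defectSpace (hS : Dense (S.domain : Set H)) (hSA : S ≤ A) :
    (defectSpace S z).map ((cayley hA hz).toLinearEquiv : H →ₗ[ℂ] H) =
      defectSpace S (conj z) := by
  ext v
  obtain ⟨u, rfl⟩ := (cayley hA hz).surjective v
  rw [cayley_mem_defectSpace_iff hA hz hS hSA]
  exact (cayley hA hz).injective.mem_set_image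

theorem eq_add_sub_cayley_iff {B : H →ₗ.[ℂ] H} (hBA : B ≤ A) {g : A.domain} {f : B.domain} {u : H} :
    (g : H) = f + (u - cayley hA hz u) ↔
      shift B (conj z) f + (z - conj z) • u = shift A (conj z) g := by
  obtain ⟨h, rfl⟩ := (shift_conj_bijective hA hz).2 u
  have hdiff : shift A (conj z) h - shift A z h = (z - conj z) • (h : H) := by
    simp only [shift_apply]; module
  have hsum : shift B (conj z) f + (z - conj z) • shift A (conj z) h =
      shift A (conj z) (⟨f, hBA.1 f.2⟩ + (z - conj z) • h) := by
    rw [map_add, map_smul]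
    simp only [shift_apply, apply_eq_of_le hBA f]
  rw [cayley_shift, hdiff, hsum, (shift_conj_bijective hA hz).1.eq_iff, Subtype.ext_iff, eq_comm]
  rfl

theorem existsUnique_eq_add_sub_cayley (hS : Dense (S.domain : Set H)) (hSA : S ≤ A)
    (g : A.domain) :
    ∃! p : S.closure.domain × defectSpace S z,
      (g : H) = p.1 + ((p.2 : H) - cayley hA hz p.2) := by
  have hclosure := closure_le_of_isClosed hA.isClosed hSA
  have hreg : IsRegularPoint A (conj z) :=
    isRegularPoint_of_im_ne_zero (isFormalAdjoint_of_isSelfAdjoint hA) (by simpa using hz)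
  simp only [eq_add_sub_cayley_iff hA hz hclosure]
  exact existsUnique_shift_closure_add_smul hS (hA.isClosed.isClosable.leIsClosable hSA)
    (hreg.mono hclosure) (sub_conj_ne_zero hz) _

end Cayley

section VonNeumann

variable {H : Type*} [NormedAddCommGroup H] [InnerProductSpace ℂ H] [CompleteSpace H]
  {S A : H →ₗ.[ℂ] H} (hS : Dense (S.domain : Set H)) (hA : IsSelfAdjoint A) (hSA : S ≤ A)
  {ε : ℝ} (hε : (Complex.I * ε).im ≠ 0)

/-- The restriction of the Cayley transform of `A` to `ker (S* - iε)`. -/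
noncomputable def vonNeumannUnitary : defectPlus S ε ≃ₗᵢ[ℂ] defectMinus S ε :=
  ((cayley hA hε).submoduleMap (defectPlus S ε)).trans
    (LinearIsometryEquiv.ofEq _ _ ((map_cayley_defectSpace hA hε hS hSA).trans (by simp)))

theorem coe_vonNeumannUnitary (u : defectPlus S ε) :
    (vonNeumannUnitary hS hA hSA hε u : H) = cayley hA hε u :=
  rfl

include hS hA hSA hε

theorem isVonNeumannParameter_iff {U : defectPlus S ε ≃ₗᵢ[ℂ] defectMinus S ε} :
    IsVonNeumannParameter S A ε U ↔ ∀ u, (U u : H) = cayley hA hε u := by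
  have hconj (u v : H) : (Complex.I * ε) • u - conj (Complex.I * (ε : ℂ)) • v =
      (Complex.I * ε) • u + (Complex.I * ε) • v := by simp
  refine ⟨fun h u => ?_, fun h => ?_⟩
  · have happly := h.apply_eq ⟨_, h.sub_mem u⟩ 0 u (zero_add _).symm
    rw [LinearPMap.map_zero, zero_add, ← hconj] at happly
    exact ((sub_mem_graph_iff hA hε).1 (A.mem_graph_iff.2 ⟨_, rfl, happly⟩)).symm
  · have hclosure := closure_le_of_isClosed hA.isClosed hSA
    have hgraph (u : defectPlus S ε) : ((u : H) - U u, (Complex.I * ε) • (u : H) +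
        (Complex.I * ε) • (U u : H)) ∈ A.graph := by
      rw [← hconj]
      exact (sub_mem_graph_iff hA hε).2 (h u).symm
    refine ⟨le_antisymm (fun g hg => ?_) (sup_le hclosure.1 ?_), fun g f u hg => ?_⟩
    · obtain ⟨p, hp, -⟩ := existsUnique_eq_add_sub_cayley hA hε hS hSA ⟨g, hg⟩
      refine Submodule.mem_sup.2 ⟨p.1, p.1.2, _, ⟨p.2, rfl⟩, ?_⟩
      rw [← h p.2] at hp
      exact hp.symm
    · rintro _ ⟨u, rfl⟩
      exact LinearPMap.mem_domain_of_mem_graph (hgraph u)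
    · have hsum := add_mem (LinearPMap.le_graph_of_le hclosure (S.closure.mem_graph f)) (hgraph u)
      obtain ⟨g', hg', hAg'⟩ := A.mem_graph_iff.1 hsum
      rw [Subtype.ext (hg.trans hg'.symm), hAg']
      exact (add_assoc _ _ _).symm

theorem existsUnique_isVonNeumannParameter :
    ∃! U : defectPlus S ε ≃ₗᵢ[ℂ] defectMinus S ε, IsVonNeumannParameter S A ε U := by
  simp only [isVonNeumannParameter_iff hS hA hSA hε]
  exact ⟨vonNeumannUnitary hS hA hSA hε, coe_vonNeumannUnitary hS hA hSA hε,
    fun U hU => LinearIsometryEquiv.ext fun u => Subtype.ext (hU u)⟩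

theorem IsVonNeumannParameter.existsUnique_eq_add_sub
    {U : defectPlus S ε ≃ₗᵢ[ℂ] defectMinus S ε} (hU : IsVonNeumannParameter S A ε U)
    (g : A.domain) :
    ∃! p : S.closure.domain × defectPlus S ε, (g : H) = p.1 + ((p.2 : H) - U p.2) := by
  simp only [(isVonNeumannParameter_iff hS hA hSA hε).1 hU]
  exact existsUnique_eq_add_sub_cayley hA hε hS hSA g

end VonNeumann

section SelfAdjointIn

variable {H : Type*} [NormedAddCommGroup H] [InnerProductSpace ℂ H] [CompleteSpace H]
  {N : Submodule ℂ H}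

/-- The linear relation in the whole space whose operator part is the operator `T`: its
multivalued part `{t | (0, t) ∈ T.relation}` is the orthogonal complement of the domain of `T`. -/
noncomputable def SelfAdjointIn.relation (T : SelfAdjointIn N) : Submodule ℂ (H × H) :=
  T.op.graph.map (T.space.subtype.prodMap T.space.subtype) ⊔ (⊥ : Submodule ℂ H).prod T.domᗮ

theorem SelfAdjointIn.mem_relation {T : SelfAdjointIn N} {x t : H} :
    (x, t) ∈ T.relation ↔ ∃ u : T.op.domain, ((u : T.space) : H) = x ∧ t - T.op u ∈ T.domᗮ := by
  rw [SelfAdjointIn.relation, Submodule.mem_sup]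
  constructor
  · rintro ⟨_, ⟨⟨x, y⟩, hxy, rfl⟩, ⟨_, w⟩, ⟨rfl, hw⟩, hsum⟩
    obtain ⟨u, rfl, rfl⟩ := T.op.mem_graph_iff.1 hxy
    obtain ⟨hx, ht⟩ := Prod.ext_iff.1 hsum
    refine ⟨u, (add_zero _).symm.trans hx, ?_⟩
    have ht : (T.op u : H) + w = t := ht
    rwa [← ht, add_sub_cancel_left]
  · rintro ⟨u, rfl, ht⟩
    exact ⟨_, ⟨_, T.op.mem_graph u, rfl⟩, (0, t - T.op u), ⟨rfl, ht⟩, by simp⟩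

theorem SelfAdjointIn.map_fst_relation (T : SelfAdjointIn N) :
    T.relation.map (LinearMap.fst ℂ H H) = T.dom := by
  ext x
  constructor
  · rintro ⟨⟨x, t⟩, hxt, rfl⟩
    obtain ⟨u, rfl, -⟩ := SelfAdjointIn.mem_relation.1 hxt
    exact ⟨_, u.2, rfl⟩
  · rintro ⟨u, hu, rfl⟩
    refine ⟨(_, T.op ⟨u, hu⟩), SelfAdjointIn.mem_relation.2 ⟨⟨u, hu⟩, rfl, ?_⟩, rfl⟩
    rw [sub_self]
    exact zero_mem _

theorem SelfAdjointIn.dom_le (T : SelfAdjointIn N) : T.dom ≤ N :=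
  (Submodule.map_subtype_le _ _).trans T.space_le

theorem SelfAdjointIn.space_eq_topologicalClosure (T : SelfAdjointIn N) :
    T.space = T.dom.topologicalClosure := by
  have : CompleteSpace T.space := T.isClosed.completeSpace_coe
  refine le_antisymm (fun x hx => ?_)
    (Submodule.topologicalClosure_minimal _ (Submodule.map_subtype_le _ _) T.isClosed)
  exact Subtype.dense_iff.1 T.isSelfAdjoint.dense_domain hx

theorem SelfAdjointIn.mem_graph_op_iff {T : SelfAdjointIn N} {p : T.space × T.space} :
    p ∈ T.op.graph ↔ ((p.1 : H), (p.2 : H)) ∈ T.relation := by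
  rw [LinearPMap.mem_graph_iff, SelfAdjointIn.mem_relation]
  refine exists_congr fun u => and_congr Subtype.ext_iff ⟨fun h => by simp [h], fun h => ?_⟩
  rw [← Submodule.orthogonal_closure, ← T.space_eq_topologicalClosure] at h
  have hzero := inner_self_eq_zero.1 (h _ (T.space.sub_mem p.2.2 (T.op u).2))
  exact Subtype.ext (sub_eq_zero.1 hzero).symm

theorem SelfAdjointIn.relation_injective :
    Function.Injective (SelfAdjointIn.relation : SelfAdjointIn N → Submodule ℂ (H × H)) := by
  intro T T' h
  have hspace : T.space = T'.space := by
    rw [T.space_eq_topologicalClosure, T'.space_eq_topologicalClosure, ← T.map_fst_relation, h,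
      T'.map_fst_relation]
  have hgraph {p : T.space × T.space} := T.mem_graph_op_iff (p := p)
  have hgraph' {p : T'.space × T'.space} := T'.mem_graph_op_iff (p := p)
  rw [h] at hgraph
  generalize T'.relation = R at hgraph hgraph'
  obtain ⟨space, _, _, op, _⟩ := T
  obtain ⟨space', _, _, op', _⟩ := T'
  subst hspace
  congr
  exact LinearPMap.eq_of_eq_graph (SetLike.ext fun p => hgraph.trans hgraph'.symm)

/-- The operator part of a self-adjoint linear relation, as a self-adjoint operator in the closure
of its domain. -/
noncomputable def SelfAdjointIn.ofRelation {R : Submodule ℂ (H × H)} (hR : R.adjoint = R)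
    (hN : closedDomain R ≤ N) : SelfAdjointIn N where
  space := closedDomain R
  space_le := hN
  isClosed := Submodule.isClosed_topologicalClosure _
  op := operatorPart R
  isSelfAdjoint :=
    haveI : CompleteSpace (closedDomain R) :=
      (Submodule.isClosed_topologicalClosure _).completeSpace_coe
    isSelfAdjoint_operatorPart hR

theorem SelfAdjointIn.relation_ofRelation {R : Submodule ℂ (H × H)} (hR : R.adjoint = R)
    (hN : closedDomain R ≤ N) : (SelfAdjointIn.ofRelation hR hN).relation = R := by
  have : CompleteSpace (closedDomain R) :=
    (Submodule.isClosed_topologicalClosure _).completeSpace_coe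
  have hdom : (SelfAdjointIn.ofRelation hR hN).domᗮ = (closedDomain R)ᗮ :=
    (congrArg Submodule.orthogonal (map_domain_operatorPart hR)).trans
      (Submodule.orthogonal_closure _).symm
  ext ⟨x, t⟩
  rw [SelfAdjointIn.mem_relation, hdom]
  constructor
  · rintro ⟨u, rfl, ht⟩
    have hu := (mem_graph_operatorPart hR).1 ((operatorPart R).mem_graph u)
    have hsum := R.add_mem hu ((mk_zero_mem_iff hR).2 ht)
    rw [Prod.mk_add_mk, add_zero] at hsum
    convert hsum using 2
    exact (add_sub_cancel _ _).symm
  · intro hxt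
    obtain ⟨hx, hgraph⟩ := mk_projection_mem_graph_operatorPart hR hxt
    obtain ⟨u, hu, hTu⟩ := (operatorPart R).mem_graph_iff.1 hgraph
    refine ⟨u, congrArg Subtype.val hu, ?_⟩
    convert (closedDomain R).sub_starProjection_mem_orthogonal t using 2
    exact congrArg Subtype.val hTu

end SelfAdjointIn

section BoundedInverse

variable {H : Type*} [NormedAddCommGroup H] [InnerProductSpace ℂ H] {S A : H →ₗ.[ℂ] H}
  {B : H →L[ℂ] H}

theorem IsBoundedInverse.isSymmetric (h : IsBoundedInverse A B) (hA : A.IsFormalAdjoint A) :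
    (B : H →ₗ[ℂ] H).IsSymmetric := fun x y => by
  have h' := hA ⟨B x, h.mem_domain x⟩ ⟨B y, h.mem_domain y⟩
  rw [h.right_inv, h.right_inv] at h'
  exact h'.symm

theorem IsBoundedInverse.apply_of_le (h : IsBoundedInverse A B) (hSA : S ≤ A) (f : S.domain) :
    B (S f) = f := by
  rw [← apply_eq_of_le hSA f, h.left_inv]

theorem oneSubComp_mem_subFromInverse (g : A.domain) :
    (oneSubComp B A g, A g) ∈ subFromInverse A.graph (B : H →ₗ[ℂ] H) := by
  have hg : oneSubComp B A g + B (A g) = g := sub_add_cancel _ _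
  exact mem_subFromInverse.2 (hg.symm ▸ A.mem_graph g)

theorem map_fst_subFromInverse_graph :
    (subFromInverse A.graph (B : H →ₗ[ℂ] H)).map (LinearMap.fst ℂ H H) =
      LinearMap.range (oneSubComp B A) := by
  ext x
  constructor
  · rintro ⟨⟨x, t⟩, hxt, rfl⟩
    obtain ⟨g, hg, rfl⟩ := A.mem_graph_iff.1 (mem_subFromInverse.1 hxt)
    exact ⟨g, sub_eq_of_eq_add hg⟩
  · rintro ⟨g, rfl⟩
    exact ⟨_, oneSubComp_mem_subFromInverse g, rfl⟩

theorem oneSubComp_eq_of_eq_add (hSA : S ≤ A) (hBS : ∀ f : S.domain, B (S f) = f)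
    {g k : A.domain} {f : S.domain} (hg : (g : H) = f + k) :
    oneSubComp B A k = oneSubComp B A g := by
  have hzero : oneSubComp B A ⟨f, hSA.1 f.2⟩ = 0 := by
    change (f : H) - B (A ⟨f, hSA.1 f.2⟩) = 0
    rw [apply_eq_of_le hSA f, hBS, sub_self]
  rw [show g = ⟨f, hSA.1 f.2⟩ + k from Subtype.ext hg, map_add, hzero, zero_add]

end BoundedInverse

section KreinVishikBirman

variable {H : Type*} [NormedAddCommGroup H] [InnerProductSpace ℂ H] [CompleteSpace H]
  {S A : H →ₗ.[ℂ] H} {B : H →L[ℂ] H}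

theorem closure_apply_mem_orthogonal_defectSpace (hS : Dense (S.domain : Set H))
    (hS' : S.IsClosable) (f : S.closure.domain) : S.closure f ∈ (defectSpace S 0)ᗮ := by
  rw [defectSpace_eq_orthogonal_closure hS hS']
  exact Submodule.le_orthogonal_orthogonal _ ⟨f, by simp [shift_apply]⟩

theorem closedDomain_subFromInverse_le (hS : Dense (S.domain : Set H)) (hA : IsSelfAdjoint A)
    (hSA : S ≤ A) (hB : (B : H →ₗ[ℂ] H).IsSymmetric) (hBS : ∀ f : S.domain, B (S f) = f) :
    closedDomain (subFromInverse A.graph (B : H →ₗ[ℂ] H)) ≤ defectSpace S 0 := by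
  have hA' := (isSelfAdjoint_iff_adjoint_graph hA.dense_domain).1 hA
  rw [defectSpace_eq_orthogonal hS]
  refine Submodule.isOrtho_iff_le.1 (Submodule.IsOrtho.symm ?_)
  rintro _ ⟨f, rfl⟩
  refine (mk_zero_mem_iff (adjoint_subFromInverse hA' hB)).1 (mem_subFromInverse.2 ?_)
  have hf := LinearPMap.le_graph_of_le hSA (S.mem_graph f)
  simpa [shift_apply, hBS f] using hf

variable {T : SelfAdjointIn (defectSpace S 0)}

theorem mem_orthogonal_dom_iff (hS : Dense (S.domain : Set H)) (hS' : S.IsClosable)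
    (hreg : IsRegularPoint S.closure 0) {y : H} :
    y ∈ T.domᗮ ↔
      ∃ f : S.closure.domain, ∃ w ∈ defectSpace S 0 ⊓ T.domᗮ, S.closure f + w = y := by
  have hrange (f : S.closure.domain) : S.closure f ∈ T.domᗮ :=
    Submodule.orthogonal_le T.dom_le (closure_apply_mem_orthogonal_defectSpace hS hS' f)
  constructor
  · intro hy
    obtain ⟨f, w, hw, rfl⟩ :=
      exists_shift_closure_add hS hS' (z := 0) (by rwa [map_zero]) y
    simp only [shift_apply, map_zero, zero_smul, sub_zero] at hy ⊢
    exact ⟨f, w, ⟨hw, (Submodule.add_mem_iff_right _ (hrange f)).1 hy⟩, rfl⟩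
  · rintro ⟨f, w, hw, rfl⟩
    exact add_mem (hrange f) hw.2

theorem mem_relation_iff_exists_closure (hS : Dense (S.domain : Set H)) (hS' : S.IsClosable)
    (hreg : IsRegularPoint S.closure 0) {x t : H} :
    (x, t) ∈ T.relation ↔ ∃ (f : S.closure.domain) (u : T.op.domain) (w : H),
      w ∈ defectSpace S 0 ⊓ T.domᗮ ∧ ((u : T.space) : H) = x ∧ S.closure f + T.op u + w = t := by
  simp only [SelfAdjointIn.mem_relation, mem_orthogonal_dom_iff hS hS' hreg, eq_sub_iff_add_eq]
  constructor
  · rintro ⟨u, hu, f, w, hw, ht⟩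
    exact ⟨f, u, w, hw, hu, by rw [← ht]; abel⟩
  · rintro ⟨f, u, w, hw, hu, ht⟩
    exact ⟨u, hu, f, w, hw, by rw [← ht]; abel⟩

theorem isKVBParameter_iff_mem_graph :
    IsKVBParameter S B A T ↔ ∀ g y : H, (g, y) ∈ A.graph ↔
      ∃ (f : S.closure.domain) (u : T.op.domain) (w : H), w ∈ defectSpace S 0 ⊓ T.domᗮ ∧
        g = f + B (T.op u + w) + ((u : T.space) : H) ∧ S.closure f + T.op u + w = y := by
  constructor
  · intro h g y
    rw [LinearPMap.mem_graph_iff]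
    constructor
    · rintro ⟨g, rfl, rfl⟩
      obtain ⟨f, u, w, hw, hg⟩ := (h.mem_domain_iff g).1 g.2
      exact ⟨f, u, w, hw, hg, (h.apply_eq g f u w hw hg).symm⟩
    · rintro ⟨f, u, w, hw, hg, rfl⟩
      have hdom := (h.mem_domain_iff g).2 ⟨f, u, w, hw, hg⟩
      exact ⟨⟨g, hdom⟩, rfl, h.apply_eq _ f u w hw hg⟩
  · refine fun h => ⟨fun g => ⟨fun hg => ?_, ?_⟩, fun g f u w hw hg => ?_⟩
    · obtain ⟨f, u, w, hw, hg, -⟩ := (h g _).1 (A.mem_graph ⟨g, hg⟩)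
      exact ⟨f, u, w, hw, hg⟩
    · rintro ⟨f, u, w, hw, hg⟩
      exact LinearPMap.mem_domain_of_mem_graph ((h g _).2 ⟨f, u, w, hw, hg, rfl⟩)
    · exact A.mem_graph_snd_inj (A.mem_graph g) ((h g _).2 ⟨f, u, w, hw, hg, rfl⟩) rfl

theorem isKVBParameter_iff_relation_eq (hS : Dense (S.domain : Set H)) (hS' : S.IsClosable)
    (hreg : IsRegularPoint S.closure 0) (hBS : ∀ f : S.closure.domain, B (S.closure f) = f) :
    IsKVBParameter S B A T ↔ T.relation = subFromInverse A.graph (B : H →ₗ[ℂ] H) := by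
  have hsplit (f : S.closure.domain) (x t w : H) :
      (f : H) + B (t + w) + x = x + B (S.closure f + t + w) := by
    simp only [map_add, hBS]; abel
  have hmem (x t : H) : (x, t) ∈ T.relation ↔
      ∃ (f : S.closure.domain) (u : T.op.domain) (w : H), w ∈ defectSpace S 0 ⊓ T.domᗮ ∧
        x + B t = f + B (T.op u + w) + ((u : T.space) : H) ∧ S.closure f + T.op u + w = t := by
    rw [mem_relation_iff_exists_closure hS hS' hreg]
    refine exists₃_congr fun f u w => and_congr_right fun _ => and_congr_left ?_
    rintro rfl
    rw [hsplit, add_left_inj, eq_comm]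
  rw [isKVBParameter_iff_mem_graph, SetLike.ext_iff, Prod.forall]
  simp only [hmem, mem_subFromInverse]
  refine ⟨fun h x t => (h _ t).symm, fun h g y => ?_⟩
  simpa using (h (g - B y) y).symm

theorem existsUnique_isKVBParameter (hS : Dense (S.domain : Set H))
    (hreg : IsRegularPoint S.closure 0) (hA : IsSelfAdjoint A) (hSA : S ≤ A)
    (hB : (B : H →ₗ[ℂ] H).IsSymmetric)
    (hBS : ∀ f : S.closure.domain, B (S.closure f) = f) :
    ∃! T : SelfAdjointIn (defectSpace S 0), IsKVBParameter S B A T := by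
  have hS' := hA.isClosed.isClosable.leIsClosable hSA
  have hR := adjoint_subFromInverse ((isSelfAdjoint_iff_adjoint_graph hA.dense_domain).1 hA) hB
  have hN := closedDomain_subFromInverse_le hS hA hSA hB fun f => by
    rw [← apply_eq_of_le S.le_closure f, hBS]
  simp only [isKVBParameter_iff_relation_eq hS hS' hreg hBS]
  refine ⟨.ofRelation hR hN, SelfAdjointIn.relation_ofRelation hR hN, fun T hT => ?_⟩
  exact SelfAdjointIn.relation_injective (hT.trans (SelfAdjointIn.relation_ofRelation hR hN).symm)

section IsKVBParameter

variable (hS : Dense (S.domain : Set H)) (hS' : S.IsClosable)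
  (hreg : IsRegularPoint S.closure 0) (hBS : ∀ f : S.closure.domain, B (S.closure f) = f)
  (hT : IsKVBParameter S B A T)

include hS hS' hreg hBS hT

theorem IsKVBParameter.dom_eq_range_oneSubComp : T.dom = LinearMap.range (oneSubComp B A) := by
  rw [← map_fst_subFromInverse_graph, ← T.map_fst_relation,
    (isKVBParameter_iff_relation_eq hS hS' hreg hBS).1 hT]

theorem IsKVBParameter.exists_coe_eq_oneSubComp (g : A.domain) :
    ∃ v : T.op.domain, ((v : T.space) : H) = oneSubComp B A g ∧
      inner ℂ ((v : T.space) : H) (A g) = inner ℂ ((v : T.space) : H) (T.op v : H) := by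
  have hg := oneSubComp_mem_subFromInverse (B := B) g
  rw [← (isKVBParameter_iff_relation_eq hS hS' hreg hBS).1 hT, SelfAdjointIn.mem_relation] at hg
  obtain ⟨v, hv, hort⟩ := hg
  have hzero := hort _ ⟨v, v.2, rfl⟩
  rw [inner_sub_right, sub_eq_zero] at hzero
  exact ⟨v, hv, hzero⟩

end IsKVBParameter

end KreinVishikBirman

section Limit

theorem IsVonNeumannParameter.inner_apply {H : Type*} [NormedAddCommGroup H]
    [InnerProductSpace ℂ H] [CompleteSpace H] {S A : H →ₗ.[ℂ] H} (hS : Dense (S.domain : Set H))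
    (hS' : S.IsClosable) {ε : ℝ} {U : defectPlus S ε ≃ₗᵢ[ℂ] defectMinus S ε}
    (hU : IsVonNeumannParameter S A ε U) {x : H} (hx : x ∈ defectSpace S 0) {g : A.domain}
    {f : S.closure.domain} {u : defectPlus S ε} (hg : (g : H) = f + ((u : H) - U u)) :
    inner ℂ x (A g) = Complex.I * ε * inner ℂ x ((u : H) + U u) := by
  rw [hU.apply_eq g f u hg, add_assoc, ← smul_add, inner_add_right, inner_smul_right,
    closure_apply_mem_orthogonal_defectSpace hS hS' f x hx, zero_add]

theorem neBot_epsToZero : epsToZero.NeBot :=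
  comap_coe_neBot_of_le_principal inf_le_right

end Limit

end ExtensionTheory

theorem mainTheorem5 {H : Type*} [NormedAddCommGroup H] [InnerProductSpace ℂ H] [CompleteSpace H]
    (S : H →ₗ.[ℂ] H) (hS_dense : Dense (S.domain : Set H)) (hS_symm : S.IsFormalAdjoint S)
    (hS_reg : IsRegularPoint S.closure 0)
    (hS_def : 1 ≤ Module.rank ℂ (defectSpace S 0))
    (SD : H →ₗ.[ℂ] H) (hSD_ext : S ≤ SD) (hSD_sa : IsSelfAdjoint SD)
    (SDinv : H →L[ℂ] H) (hSD_inv : IsBoundedInverse SD SDinv)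
    (St : H →ₗ.[ℂ] H) (hSt_ext : S ≤ St) (hSt_sa : IsSelfAdjoint St) :
    -- the extension parameters of `St` exist and are unique
    (∀ ε : ℝ, 0 < ε → ∃! U : defectPlus S ε ≃ₗᵢ[ℂ] defectMinus S ε,
      IsVonNeumannParameter S St ε U) ∧
    (∃! T : SelfAdjointIn (defectSpace S 0), IsKVBParameter S SDinv St T) ∧
    ∀ (U : ∀ ε : Set.Ioi (0 : ℝ), defectPlus S ε ≃ₗᵢ[ℂ] defectMinus S ε)
      (hU : ∀ ε : Set.Ioi (0 : ℝ), IsVonNeumannParameter S St ε (U ε))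
      (T : SelfAdjointIn (defectSpace S 0)) (_hT : IsKVBParameter S SDinv St T),
      -- every `g ∈ D(St)` is uniquely decomposed as `g = f + u - U u`
      (∀ (ε : Set.Ioi (0 : ℝ)) (g : St.domain),
        ∃! p : S.closure.domain × defectPlus S ε,
          (g : H) = (p.1 : H) + ((p.2 : H) - (U ε p.2 : H))) ∧
      -- `f ε g` and `u ε g` are the components of `g` at `ε`
      ∀ (f : ∀ _ : Set.Ioi (0 : ℝ), St.domain → S.closure.domain)
        (u : ∀ ε : Set.Ioi (0 : ℝ), St.domain → defectPlus S ε)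
        (_hdec : ∀ (ε : Set.Ioi (0 : ℝ)) (g : St.domain),
          (g : H) = (f ε g : H) + ((u ε g : H) - (U ε (u ε g) : H))),
        ((T.dom : Set H) =
          {v : H | v ∈ defectSpace S 0 ∧ ∃ g : St.domain,
            Tendsto (fun ε : Set.Ioi (0 : ℝ) =>
              oneSubComp SDinv St ⟨(u ε g : H) - (U ε (u ε g) : H), (hU ε).sub_mem (u ε g)⟩)
              epsToZero (𝓝 v)}) ∧
        ∀ g : St.domain, ∃ v : T.op.domain,
          Tendsto (fun ε : Set.Ioi (0 : ℝ) =>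
            oneSubComp SDinv St ⟨(u ε g : H) - (U ε (u ε g) : H), (hU ε).sub_mem (u ε g)⟩)
            epsToZero (𝓝 ((v : T.space) : H)) ∧
          Tendsto (fun ε : Set.Ioi (0 : ℝ) =>
            Complex.I * ((ε : ℝ) : ℂ) * inner ℂ
              (oneSubComp SDinv St ⟨(u ε g : H) - (U ε (u ε g) : H), (hU ε).sub_mem (u ε g)⟩)
              ((u ε g : H) + (U ε (u ε g) : H)))
            epsToZero (𝓝 (inner ℂ ((v : T.space) : H) (T.op v : H))) := by
  have hclosure := closure_le_of_isClosed hSt_sa.isClosed hSt_ext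
  have hS' := hSt_sa.isClosed.isClosable.leIsClosable hSt_ext
  have hB := hSD_inv.isSymmetric (isFormalAdjoint_of_isSelfAdjoint hSD_sa)
  have hBS := hSD_inv.apply_of_le (closure_le_of_isClosed hSD_sa.isClosed hSD_ext)
  have him (ε : ℝ) (hε : 0 < ε) : (Complex.I * ε).im ≠ 0 := by simpa using hε.ne'
  refine ⟨fun ε hε => existsUnique_isVonNeumannParameter hS_dense hSt_sa hSt_ext (him ε hε),
    existsUnique_isKVBParameter hS_dense hS_reg hSt_sa hSt_ext hB hBS, fun U hU T hT =>
    ⟨fun ε => (hU ε).existsUnique_eq_add_sub hS_dense hSt_sa hSt_ext (him ε ε.2),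
      fun f u hdec => ?_⟩⟩
  have hdom := hT.dom_eq_range_oneSubComp hS_dense hS' hS_reg hBS
  have hconst (ε : Set.Ioi (0 : ℝ)) (g : St.domain) :=
    oneSubComp_eq_of_eq_add hclosure hBS (k := ⟨_, (hU ε).sub_mem (u ε g)⟩) (hdec ε g)
  have := neBot_epsToZero
  simp only [hconst, tendsto_const_nhds_iff]
  refine ⟨?_, fun g => ?_⟩
  · ext v
    rw [SetLike.mem_coe, hdom]
    exact ⟨fun h => ⟨T.dom_le (hdom.ge h), h⟩, fun h => h.2⟩
  · obtain ⟨v, hv, hTv⟩ := hT.exists_coe_eq_oneSubComp hS_dense hS' hS_reg hBS g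
    have hv' : ((v : T.space) : H) ∈ defectSpace S 0 := T.dom_le ⟨v, v.2, rfl⟩
    refine ⟨v, hv.symm, ?_⟩
    rw [← hv, ← hTv]
    exact tendsto_const_nhds.congr fun ε => (hU ε).inner_apply hS_dense hS' hv' (hdec ε g)
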